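/- **Inverse Composition Theorem.** For a domain (nonempty, open, connected set) $\Omega\subset\mathbb R^2$ and $1\le r\le\infty$, let $L^1_r(\Omega)$ be the space of locally summable, weakly differentiable functions $f:\Omega\to\mathbb R$ whose weak gradient $\nabla f$ (locally summable on $\Omega$) has finite seminorm $\|f\mid L^1_r(\Omega)\|=\|\,|\nabla f|\,\|_{L^r(\Omega)}$, where $|\cdot|$ is the Euclidean norm. A homeomorphism $\varphi:\Omega\to\Omega'$ of domains is said to generate a bounded composition operator $\varphi^*:L^1_r(\Omega')\to L^1_s(\Omega)$, $\varphi^*f=f\circ\varphi$, if $f\circ\varphi\in L^1_s(\Omega)$ for every $f\in L^1_r(\Omega')$ and there is a constant $K<\infty$ with $\|f\circ\varphi\mid L^1_s(\Omega)\|\le K\,\|f\mid L^1_r(\Omega')\|$ for all $f\in L^1_r(\Omega')$. Let $\varphi:\Omega\to\Omega'$ be a ($C^1$-)diffeomorphism of domains $\Omega,\Omega'\subset\mathbb R^2$, let $1<q<p<\infty$, and let $p',q'$ be given by $\frac1p+\frac1{p'}=1$, $\frac1q+\frac1{q'}=1$. Then $\varphi$ generates a bounded composition operator $$\varphi^*:L^1_p(\Omega')\to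 L^1_q(\Omega)$$ if and only if $\varphi^{-1}:\Omega'\to\Omega$ generates a bounded composition operator $$(\varphi^{-1})^*:L^1_{q'}(\Omega)\to L^1_{p'}(\Omega').$$ -/

import Mathlib

open MeasureTheory Set
open scoped ENNReal NNReal

/-- `g` is the weak gradient of `f` on the open set `Ω ⊆ ℝⁿ`: both are locally summable on `Ω`,
and integration by parts holds against every `ψ ∈ C_c^∞(Ω)`, in every direction `v`. -/
structure HasWeakGradient {n : ℕ} (Ω : Set (EuclideanSpace ℝ (Fin n)))
    (f : EuclideanSpace ℝ (Fin n) → ℝ)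
    (g : EuclideanSpace ℝ (Fin n) → EuclideanSpace ℝ (Fin n)) : Prop where
  locallyIntegrableOn_fun : LocallyIntegrableOn f Ω volume
  locallyIntegrableOn_grad : LocallyIntegrableOn g Ω volume
  integral_eq : ∀ ψ : EuclideanSpace ℝ (Fin n) → ℝ, ContDiff ℝ (⊤ : ℕ∞) ψ → HasCompactSupport ψ →
    tsupport ψ ⊆ Ω → ∀ v : EuclideanSpace ℝ (Fin n),
      ∫ z in Ω, f z * fderiv ℝ ψ z v = - ∫ z in Ω, inner ℝ (g z) v * ψ z

/-- The seminorm `‖f | L¹_p(Ω)‖ = ‖∇f‖_{L^p(Ω)}` with values in `[0, ∞]`. The weak gradient is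
unique almost everywhere on `Ω`, so the infimum is over one common value
(see `homSobolevSeminorm_eq`); it is `∞` if `f` is not weakly differentiable. -/
noncomputable def homSobolevSeminorm {n : ℕ} (Ω : Set (EuclideanSpace ℝ (Fin n))) (p : ℝ≥0∞)
    (f : EuclideanSpace ℝ (Fin n) → ℝ) : ℝ≥0∞ :=
  ⨅ (g : EuclideanSpace ℝ (Fin n) → EuclideanSpace ℝ (Fin n)) (_ : HasWeakGradient Ω f g),
    eLpNorm g p (volume.restrict Ω)

/-- Membership in the homogeneous Sobolev space `L¹_p(Ω)`: `f` is locally summable and weakly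
differentiable on `Ω`, with finite seminorm. -/
def MemHomSobolev {n : ℕ} (Ω : Set (EuclideanSpace ℝ (Fin n))) (p : ℝ≥0∞)
    (f : EuclideanSpace ℝ (Fin n) → ℝ) : Prop :=
  (∃ g, HasWeakGradient Ω f g) ∧ homSobolevSeminorm Ω p f < ∞

/-- The map `φ : Ω → Ω'` generates a bounded composition operator
`φ^* : L¹_p(Ω') → L¹_q(Ω)`, `φ^* f = f ∘ φ`. -/
def GeneratesBoundedComposition {n : ℕ} (Ω Ω' : Set (EuclideanSpace ℝ (Fin n)))
    (φ : EuclideanSpace ℝ (Fin n) → EuclideanSpace ℝ (Fin n)) (p q : ℝ≥0∞) : Prop :=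
  (∀ f : EuclideanSpace ℝ (Fin n) → ℝ, MemHomSobolev Ω' p f → MemHomSobolev Ω q (f ∘ φ)) ∧
  ∃ K : ℝ≥0, ∀ f : EuclideanSpace ℝ (Fin n) → ℝ, MemHomSobolev Ω' p f →
    homSobolevSeminorm Ω q (f ∘ φ) ≤ K * homSobolevSeminorm Ω' p f

/-- The weak gradient is unique almost everywhere. -/
theorem HasWeakGradient.ae_eq {n : ℕ} {Ω : Set (EuclideanSpace ℝ (Fin n))} (hΩ : IsOpen Ω)
    {f : EuclideanSpace ℝ (Fin n) → ℝ}
    {g h : EuclideanSpace ℝ (Fin n) → EuclideanSpace ℝ (Fin n)}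
    (hg : HasWeakGradient Ω f g) (hh : HasWeakGradient Ω f h) :
    g =ᵐ[volume.restrict Ω] h := by
  have hd : LocallyIntegrableOn (fun z => g z - h z) Ω volume :=
    hg.locallyIntegrableOn_grad.sub hh.locallyIntegrableOn_grad
  have key : ∀ᵐ x ∂(volume : Measure (EuclideanSpace ℝ (Fin n))), x ∈ Ω → g x - h x = 0 := by
    refine hΩ.ae_eq_zero_of_integral_contDiff_smul_eq_zero hd ?_
    intro ψ hψ hc hs
    have hint : ∀ u : EuclideanSpace ℝ (Fin n) → EuclideanSpace ℝ (Fin n),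
        LocallyIntegrableOn u Ω volume → Integrable (fun z => ψ z • u z) volume := fun u hu =>
      (integrableOn_iff_integrable_of_support_subset fun z hz => by
        by_contra hz'
        exact hz (by simp [image_eq_zero_of_notMem_tsupport hz'])).1
        ((hu.integrableOn_compact_subset hs hc).continuousOn_smul hψ.continuous.continuousOn hc)
    have hzero : ∀ u : EuclideanSpace ℝ (Fin n) → EuclideanSpace ℝ (Fin n),
        ∀ v : EuclideanSpace ℝ (Fin n), LocallyIntegrableOn u Ω volume →
        ∫ z in Ω, inner ℝ (u z) v * ψ z = inner ℝ v (∫ z, ψ z • u z) := by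
      intro u v hu
      rw [← integral_inner (hint u hu) v, setIntegral_eq_integral_of_forall_compl_eq_zero]
      · refine integral_congr_ae (.of_forall fun z => ?_)
        simp only [inner_smul_right, real_inner_comm]
        ring
      · intro z hz
        have : ψ z = 0 := image_eq_zero_of_notMem_tsupport fun hz' => hz (hs hz')
        simp [this]
    refine ext_inner_left ℝ fun v => ?_
    have e1 := hg.integral_eq ψ hψ hc hs v
    have e2 := hh.integral_eq ψ hψ hc hs v
    rw [hzero g v hg.locallyIntegrableOn_grad] at e1
    rw [hzero h v hh.locallyIntegrableOn_grad] at e2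
    simp only [smul_sub]
    rw [integral_sub (hint g hg.locallyIntegrableOn_grad) (hint h hh.locallyIntegrableOn_grad),
      inner_sub_right, inner_zero_right]
    linarith
  rw [Filter.EventuallyEq, ae_restrict_iff' hΩ.measurableSet]
  filter_upwards [key] with x hx hxΩ using sub_eq_zero.1 (hx hxΩ)

/-- The seminorm is the `L^p` norm of any weak gradient. -/
theorem homSobolevSeminorm_eq {n : ℕ} {Ω : Set (EuclideanSpace ℝ (Fin n))} (hΩ : IsOpen Ω)
    (p : ℝ≥0∞) {f : EuclideanSpace ℝ (Fin n) → ℝ}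
    {g : EuclideanSpace ℝ (Fin n) → EuclideanSpace ℝ (Fin n)} (hg : HasWeakGradient Ω f g) :
    homSobolevSeminorm Ω p f = eLpNorm g p (volume.restrict Ω) :=
  le_antisymm (iInf₂_le g hg)
    (le_iInf₂ fun _ hh => (eLpNorm_congr_ae (hg.ae_eq hΩ hh)).le)

/-! Write `J = det Dφ` and `1/κ = 1/q - 1/p`. Boundedness of `φ^*` forces the directional
dilatations `|J|^(-1/p) ‖(Dφ)ᵀ e‖` into `L^κ(Ω)`, and in the plane this is enough for `φ⁻¹` to act
between the conjugate spaces.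

Necessity: insert `l⁻¹ u(y) sin(l⟨e,y⟩ + α)`, whose gradient is `u cos(l⟨e,y⟩ + α) e + O(1/l)`. Two
phases a quarter period apart remove the cosine, and `l → ∞` leaves `‖u∘φ · (Dφ)ᵀe‖_q ≤ C ‖u‖_p`
(`exists_eLpNorm_smul_adjoint_le`). A change of variables makes this a bound for multiplication by
the dilatation from `L^p` to `L^q`. Testing on a power of the dilatation, cut off to compact sets,
gives the `L^κ` bound (`eLpNorm_le_of_forall_eLpNorm_mul_le`).

Sufficiency: for 2×2 matrices the adjugate has the same entries up to sign and order, so `|J|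
‖(Dφ)⁻¹‖` is at most the sum of the row norms of `Dφ` (`abs_det_mul_opNorm_le`). As `1/p' = 1 -
1/p`, the factor `|J|^(1/p') ‖(Dφ)⁻¹‖` is bounded by a sum of two dilatations. As `1/p' = 1/q' +
1/κ` with the same `κ`, Hölder's inequality bounds `(φ⁻¹)^*`. The converse is this implication
applied to `φ⁻¹`, since conjugation is an involution.

Both halves need the chain rule for weak gradients (`HasWeakGradient.comp_openPartialHomeomorph`).
For a `C^1` map the transported test fields are merely continuous, so integration by parts is first
extended to such fields by mollification. -/

open Filter Topology

/-! ### Functions vanishing off a compact subset of an open set -/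

/-- A function continuous on an open set and vanishing there off a compact subset extends by zero
to a continuous function. -/
theorem continuous_indicator_of_isCompact {X F : Type*} [TopologicalSpace X] [T2Space X]
    [TopologicalSpace F] [Zero F] {U K : Set X} {h : X → F} (hU : IsOpen U) (hK : IsCompact K)
    (hKU : K ⊆ U) (hh : ContinuousOn h U) (h0 : ∀ x ∈ U, x ∉ K → h x = 0) :
    Continuous (U.indicator h) := by
  refine continuous_iff_continuousAt.2 fun x => ?_
  by_cases hx : x ∈ U
  · refine (hh.continuousAt (hU.mem_nhds hx)).congr ?_
    filter_upwards [hU.mem_nhds hx] with y hy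
    rw [indicator_of_mem hy]
  · have hxK : x ∈ Kᶜ := fun h => hx (hKU h)
    have : (fun _ => (0 : F)) =ᶠ[𝓝 x] U.indicator h := by
      filter_upwards [hK.isClosed.isOpen_compl.mem_nhds hxK] with y hy
      by_cases hyU : y ∈ U
      · rw [indicator_of_mem hyU, h0 y hyU hy]
      · rw [indicator_of_notMem hyU]
    exact continuousAt_const.congr this

theorem support_indicator_subset_of_isCompact {X F : Type*} [Zero F] {U K : Set X} {h : X → F}
    (h0 : ∀ x ∈ U, x ∉ K → h x = 0) :
    Function.support (U.indicator h) ⊆ K := by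
  intro x hx
  by_contra hxK
  by_cases hxU : x ∈ U
  · exact hx (by rw [indicator_of_mem hxU, h0 x hxU hxK])
  · exact hx (indicator_of_notMem hxU _)

/-- A function with values in `F` that is continuous on `Ω`, and vanishes on `Ω` off a compact
subset of `Ω`, is in every `L^p(Ω)`. -/
theorem memLp_restrict_of_continuousOn {E F : Type*} [NormedAddCommGroup E]
    [MeasurableSpace E] [BorelSpace E] [NormedAddCommGroup F] [SecondCountableTopology E]
    {μ : Measure E} [IsFiniteMeasureOnCompacts μ] {U K : Set E} {h : E → F} (hU : IsOpen U)
    (hK : IsCompact K) (hKU : K ⊆ U)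
    (hh : ContinuousOn h U) (h0 : ∀ x ∈ U, x ∉ K → h x = 0) (p : ℝ≥0∞) :
    MemLp h p (μ.restrict U) := by
  have hc := continuous_indicator_of_isCompact hU hK hKU hh h0
  have hs := support_indicator_subset_of_isCompact (F := F) (h := h) h0
  have hcs : HasCompactSupport (U.indicator h) := HasCompactSupport.of_support_subset_isCompact hK hs
  exact (memLp_indicator_iff_restrict hU.measurableSet).1 (hc.memLp_of_hasCompactSupport hcs)

theorem MeasureTheory.LocallyIntegrableOn.integrableOn_mul_of_support_subset {E : Type*}
    [NormedAddCommGroup E] [MeasurableSpace E] [BorelSpace E]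
    {μ : Measure E} {U K : Set E} {f w : E → ℝ} (hf : LocallyIntegrableOn f U μ)
    (hU : IsOpen U) (hK : IsCompact K) (hKU : K ⊆ U) (hw : Continuous w)
    (hwK : Function.support w ⊆ K) : IntegrableOn (fun z => f z * w z) U μ := by
  have h := (hf.integrableOn_compact_subset hKU hK).mul_continuousOn hw.continuousOn hK
  refine h.of_forall_sdiff_eq_zero hU.measurableSet fun z hz => ?_
  by_contra h
  exact hz.2 (hwK fun h' => h (by simp [h']))

/-! ### Mollification -/

section Mollification

variable {E : Type*} [NormedAddCommGroup E] [InnerProductSpace ℝ E] [FiniteDimensional ℝ E]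
  [MeasurableSpace E] [BorelSpace E]

open ContinuousLinearMap in
theorem tsupport_normed_convolution_subset (ρ : ContDiffBump (0 : E)) {δ : ℝ} (hρ : ρ.rOut ≤ δ)
    {K : Set E} {u : E → ℝ} (hu : Function.support u ⊆ K) :
    tsupport (convolution (ρ.normed volume) u (lsmul ℝ ℝ) volume) ⊆ Metric.cthickening δ K := by
  refine closure_minimal ?_ Metric.isClosed_cthickening
  refine (support_convolution_subset _).trans ?_
  rintro _ ⟨a, ha, b, hb, rfl⟩
  rw [ρ.support_normed_eq] at ha
  refine Metric.mem_cthickening_of_dist_le _ b _ _ (hu hb) ?_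
  simpa using (mem_ball_zero_iff.1 ha).le.trans hρ

open ContinuousLinearMap in
/-- Mollifications of a continuous compactly supported function converge when paired with a locally
integrable function. -/
theorem tendsto_integral_mul_normed_convolution {U K : Set E} {f u : E → ℝ} {δ : ℝ}
    {ρ : ℕ → ContDiffBump (0 : E)} (hf : LocallyIntegrableOn f U volume)
    (hu : Continuous u) (hK : IsCompact K) (huK : Function.support u ⊆ K)
    (hKU : Metric.cthickening δ K ⊆ U) (hρ : ∀ k, (ρ k).rOut ≤ δ)
    (hρ0 : Tendsto (fun k => (ρ k).rOut) atTop (𝓝 0)) :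
    Tendsto (fun k => ∫ z in U, f z * convolution ((ρ k).normed volume) u (lsmul ℝ ℝ) volume z)
      atTop (𝓝 (∫ z in U, f z * u z)) := by
  have hK' : IsCompact (Metric.cthickening δ K) := hK.cthickening
  have hcu : HasCompactSupport u := HasCompactSupport.of_support_subset_isCompact hK huK
  obtain ⟨C, hC⟩ := hcu.exists_bound_of_continuous hu
  have hC0 : 0 ≤ C := (norm_nonneg _).trans (hC 0)
  have hfK : IntegrableOn f (Metric.cthickening δ K) volume := hf.integrableOn_compact_subset hKU hK'
  -- All mollifications live in one compact thickening of `K`, where `f` is integrable; domination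
  -- is then by `C‖f‖`.
  have hrw : ∀ w : E → ℝ, (∀ z, z ∉ Metric.cthickening δ K → w z = 0) →
      ∫ z in U, f z * w z = ∫ z in Metric.cthickening δ K, f z * w z := by
    intro w hw
    rw [setIntegral_eq_integral_of_forall_compl_eq_zero fun z hz => by
        rw [hw z fun h => hz (hKU h), mul_zero],
      setIntegral_eq_integral_of_forall_compl_eq_zero fun z hz => by rw [hw z hz, mul_zero]]
  have h0 : ∀ k z, z ∉ Metric.cthickening δ K →
      convolution ((ρ k).normed volume) u (lsmul ℝ ℝ) volume z = 0 := fun k z hz =>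
    image_eq_zero_of_notMem_tsupport fun h =>
      hz (tsupport_normed_convolution_subset (ρ k) (hρ k) huK h)
  simp_rw [fun k => hrw _ (h0 k)]
  rw [hrw u fun z hz => by
    by_contra h
    exact hz (Metric.self_subset_cthickening K (huK h))]
  refine tendsto_integral_of_dominated_convergence (fun z => ‖f z‖ * C) ?_ (hfK.norm.mul_const C)
    ?_ ?_
  · intro k
    refine hfK.aestronglyMeasurable.mul (Continuous.aestronglyMeasurable ?_)
    exact ((ρ k).hasCompactSupport_normed).continuous_convolution_left _
      ((ρ k).continuous_normed) hu.locallyIntegrable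
  · intro k
    refine .of_forall fun z => ?_
    rw [norm_mul]
    gcongr
    rw [← dist_zero_right]
    exact dist_convolution_le hC0 (ρ k).support_normed_eq.subset (ρ k).nonneg_normed
      (ρ k).integral_normed hu.aestronglyMeasurable fun x _ => by simpa using hC x
  · refine .of_forall fun z => ?_
    exact (ContDiffBump.convolution_tendsto_right_of_continuous hρ0 hu z).const_mul _

-- The derivative falls on the kernel, since `u` is only continuous.
open ContinuousLinearMap in
theorem fderiv_normed_convolution_apply (ρ : ContDiffBump (0 : E)) {u : E → ℝ} (hu : Continuous u)
    (y v : E) :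
    fderiv ℝ (convolution (ρ.normed volume) u (lsmul ℝ ℝ) volume) y v
      = ∫ t, fderiv ℝ (ρ.normed volume) (y - t) v * u t := by
  have h1 := (ρ.hasCompactSupport_normed (μ := (volume : Measure E))).hasFDerivAt_convolution_left (μ := volume)
    (lsmul ℝ ℝ : ℝ →L[ℝ] ℝ →L[ℝ] ℝ) (ρ.contDiff_normed) hu.locallyIntegrable y
  have h2 := ((ρ.hasCompactSupport_normed (μ := (volume : Measure E))).fderiv ℝ).convolutionExists_left
    (precompL E (lsmul ℝ ℝ : ℝ →L[ℝ] ℝ →L[ℝ] ℝ)) (μ := volume)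
    ((ρ.contDiff_normed (n := 1) (μ := (volume : Measure E))).continuous_fderiv one_ne_zero) hu.locallyIntegrable y
  rw [h1.fderiv, convolution_eq_swap, ContinuousLinearMap.integral_apply h2.integrable_swap]
  simp

end Mollification

/-! ### Integration by parts for weak gradients -/

/-- Integration by parts of a weakly differentiable function against a continuous compactly
supported vector field `X` whose distributional divergence is the continuous function `θ`. -/
theorem HasWeakGradient.integral_mul_eq_neg_integral_inner {n : ℕ}
    {U K : Set (EuclideanSpace ℝ (Fin n))} {f θ : EuclideanSpace ℝ (Fin n) → ℝ}
    {g X : EuclideanSpace ℝ (Fin n) → EuclideanSpace ℝ (Fin n)} (hU : IsOpen U)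
    (hfg : HasWeakGradient U f g) (hK : IsCompact K) (hKU : K ⊆ U)
    (hθ : Continuous θ) (hX : Continuous X)
    (hθK : Function.support θ ⊆ K) (hXK : Function.support X ⊆ K)
    (hdiv : ∀ η : EuclideanSpace ℝ (Fin n) → ℝ, ContDiff ℝ 1 η →
      ∫ y, η y * θ y = - ∫ y, fderiv ℝ η y (X y)) :
    ∫ y in U, f y * θ y = - ∫ y in U, inner ℝ (g y) (X y) := by
  obtain ⟨δ, hδ, hδU⟩ := hK.exists_cthickening_subset_open hU hKU
  obtain ⟨ρ, hρ, hρ0⟩ : ∃ ρ : ℕ → ContDiffBump (0 : EuclideanSpace ℝ (Fin n)),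
      (∀ k, (ρ k).rOut ≤ δ) ∧ Tendsto (fun k => (ρ k).rOut) atTop (𝓝 0) := by
    refine ⟨fun k => ⟨δ / (k + 2), δ / (k + 1), by positivity, by gcongr; norm_num⟩, fun k => ?_, ?_⟩
    · exact div_le_self hδ.le (by simp)
    · exact tendsto_const_div_atTop_nhds_zero_nat δ |>.comp (tendsto_add_atTop_nat 1) |>.congr
        fun k => by simp
  set e := EuclideanSpace.basisFun (Fin n) ℝ with he
  have hXi : ∀ i, Continuous fun y => X y i := fun i => by fun_prop
  have hXiK : ∀ i, Function.support (fun y => X y i) ⊆ K := fun i y hy => hXK fun h => hy (by simp [h])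
  have hgi : ∀ i, LocallyIntegrableOn (fun y => g y i) U volume := fun i y hy => by
    obtain ⟨s, hs, hs'⟩ := hfg.locallyIntegrableOn_grad y hy
    exact ⟨s, hs, (EuclideanSpace.proj (𝕜 := ℝ) i).integrable_comp hs'⟩
  let R : ℕ → (EuclideanSpace ℝ (Fin n) → ℝ) → EuclideanSpace ℝ (Fin n) → ℝ := fun k u =>
    convolution ((ρ k).normed volume) u (ContinuousLinearMap.lsmul ℝ ℝ) volume
  have hsmooth : ∀ k u, Continuous u → ContDiff ℝ (⊤ : ℕ∞) (R k u) := fun k u hu =>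
    (ρ k).hasCompactSupport_normed.contDiff_convolution_left _ (ρ k).contDiff_normed
      hu.locallyIntegrable
  have hsupp : ∀ k u, Function.support u ⊆ K → tsupport (R k u) ⊆ Metric.cthickening δ K :=
    fun k u hu => tsupport_normed_convolution_subset (ρ k) (hρ k) hu
  have hcomp : ∀ k u, Function.support u ⊆ K → HasCompactSupport (R k u) := fun k u hu =>
    HasCompactSupport.of_support_subset_isCompact hK.cthickening
      ((subset_tsupport _).trans (hsupp k u hu))
  -- Mollifying commutes with the distributional divergence: `hdiv` with `η(t) = ρ(y - t)` says that
  -- the smooth field `ρ * X` has classical divergence `ρ * θ`.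
  have hdivk : ∀ k y, ∑ i, fderiv ℝ (R k fun y => X y i) y (e i) = R k θ y := by
    intro k y
    have hd : ContDiff ℝ 1 ((ρ k).normed (volume : Measure (EuclideanSpace ℝ (Fin n)))) :=
      (ρ k).contDiff_normed
    have hη : ContDiff ℝ 1 fun t => (ρ k).normed (volume : Measure (EuclideanSpace ℝ (Fin n))) (y - t) :=
      hd.comp (contDiff_const.sub contDiff_id)
    have hη' : ∀ t v, fderiv ℝ (fun t => (ρ k).normed (volume : Measure (EuclideanSpace ℝ (Fin n))) (y - t)) t v
        = - fderiv ℝ ((ρ k).normed (volume : Measure (EuclideanSpace ℝ (Fin n)))) (y - t) v := by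
      intro t v
      have := (hd.differentiable one_ne_zero (y - t)).hasFDerivAt.comp t
        ((hasFDerivAt_id t).const_sub y)
      refine (congrArg (fun L => L v) (HasFDerivAt.fderiv this)).trans ?_
      simp
    have hint : ∀ i, Integrable fun t =>
        fderiv ℝ ((ρ k).normed (volume : Measure (EuclideanSpace ℝ (Fin n)))) (y - t) (e i) * X t i := by
      intro i
      refine Continuous.integrable_of_hasCompactSupport ?_ ?_
      · have := hd.continuous_fderiv one_ne_zero
        fun_prop
      · exact HasCompactSupport.mul_left (HasCompactSupport.of_support_subset_isCompact hK (hXiK i))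
    have hR : R k θ y = ∫ t, (ρ k).normed volume (y - t) * θ t := by
      simp only [R]
      rw [convolution_eq_swap]
      simp
    rw [hR, hdiv _ hη]
    simp_rw [hη', integral_neg, neg_neg, R, fderiv_normed_convolution_apply (ρ k) (hXi _)]
    rw [← integral_finsetSum _ fun i _ => hint i]
    congr 1 with t
    conv_rhs => rw [← e.sum_repr (X t), map_sum]
    refine Finset.sum_congr rfl fun i _ => ?_
    rw [map_smul, smul_eq_mul, mul_comm]
    simp [he]
  have hk : ∀ k, ∫ y in U, f y * R k θ y = - ∑ i, ∫ y in U, g y i * R k (fun y => X y i) y := by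
    intro k
    simp_rw [← hdivk, Finset.mul_sum]
    rw [integral_finsetSum, ← Finset.sum_neg_distrib]
    · refine Finset.sum_congr rfl fun i _ => ?_
      rw [hfg.integral_eq _ (hsmooth k _ (hXi i)) (hcomp k _ (hXiK i))
        ((hsupp k _ (hXiK i)).trans hδU)]
      simp [he, EuclideanSpace.inner_single_right]
    · intro i _
      refine hfg.locallyIntegrableOn_fun.integrableOn_mul_of_support_subset hU hK.cthickening hδU
        (((hsmooth k _ (hXi i)).continuous_fderiv (by simp)).clm_apply continuous_const) ?_
      refine (Function.support_subset_iff'.2 fun x hx => ?_ : _ ⊆ tsupport _).trans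
        (hsupp k _ (hXiK i))
      rw [fderiv_of_notMem_tsupport ℝ hx, zero_apply]
  have l1 := tendsto_integral_mul_normed_convolution hfg.locallyIntegrableOn_fun hθ hK hθK hδU hρ hρ0
  have l2 := fun i => tendsto_integral_mul_normed_convolution (hgi i) (hXi i) hK (hXiK i) hδU hρ hρ0
  have l3 := (tendsto_finsetSum Finset.univ fun i _ => l2 i).neg
  have l4 := tendsto_nhds_unique (l1.congr hk) l3
  rw [l4, ← integral_finsetSum]
  · congr 2 with y
    simp [PiLp.inner_apply, mul_comm]
  · intro i _
    exact (hgi i).integrableOn_mul_of_support_subset hU hK hKU (hXi i) (hXiK i)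

/-- The classical gradient of a `C^1` function is its weak gradient. -/
theorem ContDiffOn.hasWeakGradient {n : ℕ} {U : Set (EuclideanSpace ℝ (Fin n))}
    {h : EuclideanSpace ℝ (Fin n) → ℝ} (hU : IsOpen U) (hh : ContDiffOn ℝ 1 h U) :
    HasWeakGradient U h (gradient h) := by
  have hd : ContinuousOn (fderiv ℝ h) U := hh.continuousOn_fderiv_of_isOpen hU le_rfl
  have hg : ContinuousOn (gradient h) U :=
    (InnerProductSpace.toDual ℝ (EuclideanSpace ℝ (Fin n))).symm.continuous.comp_continuousOn hd
  refine ⟨hh.continuousOn.locallyIntegrableOn hU.measurableSet,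
    hg.locallyIntegrableOn hU.measurableSet, fun ψ hψ hψc hψU v => ?_⟩
  have hi : ∀ w : EuclideanSpace ℝ (Fin n) → ℝ, ContinuousOn w U →
      (∀ x ∈ U, x ∉ tsupport ψ → w x = 0) → IntegrableOn w U volume := fun w hw hw0 =>
    memLp_one_iff_integrable.1 (memLp_restrict_of_continuousOn hU hψc hψU hw hw0 1)
  have h0 : ∀ w : EuclideanSpace ℝ (Fin n) → ℝ, (∀ x, x ∉ tsupport ψ → w x = 0) →
      ContinuousOn w U → Integrable w volume := fun w hw hwc =>
    (integrableOn_iff_integrable_of_support_subset fun x hx => hψU (by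
      by_contra h
      exact hx (hw x h))).1 (hi w hwc fun x _ => hw x)
  have h1 : ∀ x, x ∉ tsupport ψ → ψ x = 0 := fun x hx => image_eq_zero_of_notMem_tsupport hx
  have h2 : ∀ x, x ∉ tsupport ψ → fderiv ℝ ψ x v = 0 := fun x hx => by
    rw [fderiv_of_notMem_tsupport ℝ hx, zero_apply]
  have hψ' : Continuous fun x => fderiv ℝ ψ x v :=
    (hψ.continuous_fderiv (by simp)).clm_apply continuous_const
  rw [setIntegral_eq_integral_of_forall_compl_eq_zero fun x hx => by
      rw [h2 x fun h => hx (hψU h), mul_zero],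
    setIntegral_eq_integral_of_forall_compl_eq_zero fun x hx => by
      rw [h1 x fun h => hx (hψU h), mul_zero],
    integral_mul_fderiv_eq_neg_fderiv_mul_of_integrable]
  · simp [gradient]
  · exact h0 _ (fun x hx => by rw [h1 x hx, mul_zero])
      ((hd.clm_apply continuousOn_const).mul hψ.continuous.continuousOn)
  · exact h0 _ (fun x hx => by rw [h2 x hx, mul_zero]) (hh.continuousOn.mul hψ'.continuousOn)
  · exact h0 _ (fun x hx => by rw [h1 x hx, mul_zero])
      (hh.continuousOn.mul hψ.continuous.continuousOn)
  · exact fun x hx => (hh.differentiableOn one_ne_zero).differentiableAt (hU.mem_nhds (hψU hx))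
  · exact fun x _ => hψ.differentiable (by simp) x

/-! ### Jacobians and change of variables -/

namespace OpenPartialHomeomorph

variable {E : Type*} [NormedAddCommGroup E] [NormedSpace ℝ E] {φ : OpenPartialHomeomorph E E}

theorem hasFDerivAt_of_contDiffOn (hφ : ContDiffOn ℝ 1 φ φ.source) {x : E} (hx : x ∈ φ.source) :
    HasFDerivAt φ (fderiv ℝ φ x) x :=
  ((hφ.differentiableOn one_ne_zero).differentiableAt (φ.open_source.mem_nhds hx)).hasFDerivAt

theorem fderiv_symm_apply_fderiv (hφ : ContDiffOn ℝ 1 φ φ.source)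
    (hφ' : ContDiffOn ℝ 1 φ.symm φ.target) {x : E} (hx : x ∈ φ.source) (v : E) :
    fderiv ℝ φ.symm (φ x) (fderiv ℝ φ x v) = v := by
  have h1 := (φ.symm.hasFDerivAt_of_contDiffOn hφ' (φ.map_source hx)).comp x
    (hasFDerivAt_of_contDiffOn hφ hx)
  have h2 : HasFDerivAt (φ.symm ∘ φ) (ContinuousLinearMap.id ℝ E) x :=
    (hasFDerivAt_id x).congr_of_eventuallyEq (by
      filter_upwards [φ.open_source.mem_nhds hx] with y hy using φ.left_inv hy)
  exact DFunLike.congr_fun (h1.unique h2) v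

theorem det_fderiv_symm_mul_det_fderiv (hφ : ContDiffOn ℝ 1 φ φ.source)
    (hφ' : ContDiffOn ℝ 1 φ.symm φ.target) {x : E} (hx : x ∈ φ.source) :
    (fderiv ℝ φ.symm (φ x)).det * (fderiv ℝ φ x).det = 1 := by
  rw [ContinuousLinearMap.det, ContinuousLinearMap.det, ← LinearMap.det_comp]
  convert! LinearMap.det_id
  ext v
  exact fderiv_symm_apply_fderiv hφ hφ' hx v

theorem det_fderiv_ne_zero (hφ : ContDiffOn ℝ 1 φ φ.source)
    (hφ' : ContDiffOn ℝ 1 φ.symm φ.target) {x : E} (hx : x ∈ φ.source) :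
    (fderiv ℝ φ x).det ≠ 0 :=
  right_ne_zero_of_mul_eq_one (det_fderiv_symm_mul_det_fderiv hφ hφ' hx)

theorem continuousOn_fderiv (hφ : ContDiffOn ℝ 1 φ φ.source) :
    ContinuousOn (fderiv ℝ φ) φ.source :=
  hφ.continuousOn_fderiv_of_isOpen φ.open_source le_rfl

theorem continuousOn_abs_det_fderiv [FiniteDimensional ℝ E] (hφ : ContDiffOn ℝ 1 φ φ.source) :
    ContinuousOn (fun x => |(fderiv ℝ φ x).det|) φ.source :=
  (ContinuousLinearMap.continuous_det.comp_continuousOn (continuousOn_fderiv hφ)).abs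

variable [FiniteDimensional ℝ E] [MeasurableSpace E] [BorelSpace E] {μ : Measure E}
  [μ.IsAddHaarMeasure]

theorem lintegral_target_eq (hφ : ContDiffOn ℝ 1 φ φ.source) (G : E → ℝ≥0∞) :
    ∫⁻ y in φ.target, G y ∂μ
      = ∫⁻ x in φ.source, ENNReal.ofReal |(fderiv ℝ φ x).det| * G (φ x) ∂μ := by
  rw [← φ.image_source_eq_target]
  exact lintegral_image_eq_lintegral_abs_det_fderiv_mul μ φ.open_source.measurableSet
    (fun x hx => (hasFDerivAt_of_contDiffOn hφ hx).hasFDerivWithinAt) φ.injOn G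

theorem integral_target_eq {F : Type*} [NormedAddCommGroup F] [NormedSpace ℝ F]
    (hφ : ContDiffOn ℝ 1 φ φ.source) (G : E → F) :
    ∫ y in φ.target, G y ∂μ = ∫ x in φ.source, |(fderiv ℝ φ x).det| • G (φ x) ∂μ := by
  rw [← φ.image_source_eq_target]
  exact integral_image_eq_integral_abs_det_fderiv_smul μ φ.open_source.measurableSet
    (fun x hx => (hasFDerivAt_of_contDiffOn hφ hx).hasFDerivWithinAt) φ.injOn G

/-- Change of variables gives integrability of `|J| • (f ∘ φ)` on compact sets, and `|J|⁻¹` is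
continuous there. -/
theorem locallyIntegrableOn_comp {F : Type*} [NormedAddCommGroup F] [NormedSpace ℝ F]
    (hφ : ContDiffOn ℝ 1 φ φ.source) (hφ' : ContDiffOn ℝ 1 φ.symm φ.target) {f : E → F}
    (hf : LocallyIntegrableOn f φ.target μ) : LocallyIntegrableOn (f ∘ φ) φ.source μ := by
  refine (locallyIntegrableOn_iff φ.open_source.isLocallyClosed).2 fun K hKs hK => ?_
  have h1 : IntegrableOn f (φ '' K) μ := by
    refine hf.integrableOn_compact_subset ?_ (hK.image_of_continuousOn (φ.continuousOn.mono hKs))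
    exact (image_mono hKs).trans φ.image_source_eq_target.subset
  rw [integrableOn_image_iff_integrableOn_abs_det_fderiv_smul μ hK.measurableSet
    (fun x hx => (hasFDerivAt_of_contDiffOn hφ (hKs hx)).hasFDerivWithinAt)
    (φ.injOn.mono hKs)] at h1
  have h2 := h1.continuousOn_smul
    (((continuousOn_abs_det_fderiv hφ).mono hKs).inv₀ fun x hx =>
      abs_ne_zero.2 (det_fderiv_ne_zero hφ hφ' (hKs hx))) hK
  refine h2.congr_fun (fun x hx => ?_) hK.measurableSet
  simp [smul_smul, inv_mul_cancel₀ (abs_ne_zero.2 (det_fderiv_ne_zero hφ hφ' (hKs hx)))]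

end OpenPartialHomeomorph

theorem MeasureTheory.LocallyIntegrableOn.clm_apply {E F G : Type*} [NormedAddCommGroup E]
    [LocallyCompactSpace E] [SecondCountableTopology E]
    [NormedAddCommGroup F] [NormedSpace ℝ F] [NormedAddCommGroup G]
    [NormedSpace ℝ G] [MeasurableSpace E] [BorelSpace E] {μ : Measure E} {U : Set E}
    {A : E → F →L[ℝ] G} {g : E → F} (hU : IsOpen U) (hA : ContinuousOn A U)
    (hg : LocallyIntegrableOn g U μ) : LocallyIntegrableOn (fun x => A x (g x)) U μ := by
  refine (locallyIntegrableOn_iff hU.isLocallyClosed).2 fun K hKU hK => ?_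
  have h1 := hg.integrableOn_compact_subset hKU hK
  obtain ⟨C, hC⟩ := hK.exists_bound_of_continuousOn (hA.mono hKU)
  refine Integrable.mono' (h1.norm.const_mul C) ?_ ?_
  · exact (ContinuousLinearMap.id ℝ (F →L[ℝ] G)).aestronglyMeasurable_comp₂
      ((hA.mono hKU).aestronglyMeasurable_of_isCompact hK hK.measurableSet) h1.aestronglyMeasurable
  · refine (ae_restrict_iff' hK.measurableSet).2 (.of_forall fun x hx => ?_)
    exact (A x).le_of_opNorm_le (hC x hx) _

/-! ### Chain rule for weak gradients -/

open ContinuousLinearMap in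
/-- The chain rule for weak gradients under a `C^1` diffeomorphism. -/
theorem HasWeakGradient.comp_openPartialHomeomorph {n : ℕ}
    {φ : OpenPartialHomeomorph (EuclideanSpace ℝ (Fin n)) (EuclideanSpace ℝ (Fin n))}
    (hφ : ContDiffOn ℝ 1 φ φ.source) (hφ' : ContDiffOn ℝ 1 φ.symm φ.target)
    {f : EuclideanSpace ℝ (Fin n) → ℝ} {g : EuclideanSpace ℝ (Fin n) → EuclideanSpace ℝ (Fin n)}
    (hfg : HasWeakGradient φ.target f g) :
    HasWeakGradient φ.source (f ∘ φ) (fun x => adjoint (fderiv ℝ φ x) (g (φ x))) := by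
  refine ⟨φ.locallyIntegrableOn_comp hφ hφ' hfg.locallyIntegrableOn_fun,
    (φ.locallyIntegrableOn_comp hφ hφ' hfg.locallyIntegrableOn_grad).clm_apply φ.open_source
      (adjoint.continuous.comp_continuousOn (φ.continuousOn_fderiv hφ)),
    fun ψ hψ hψc hψU v => ?_⟩
  have hcov : ∀ H : EuclideanSpace ℝ (Fin n) → ℝ, ∫ x in φ.source, H x
      = ∫ y in φ.target, |(fderiv ℝ φ.symm y).det| * H (φ.symm y) :=
    fun H => φ.symm.integral_target_eq hφ' H
  set K := φ '' tsupport ψ with hKdef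
  have hK : IsCompact K :=
    IsCompact.image_of_continuousOn hψc (φ.continuousOn.mono hψU)
  have hKU : K ⊆ φ.target := (image_mono hψU).trans φ.image_source_eq_target.subset
  have hoff : ∀ y ∈ φ.target, y ∉ K → φ.symm y ∉ tsupport ψ := fun y hy hyK h =>
    hyK ⟨φ.symm y, h, φ.right_inv hy⟩
  have hdet : ContinuousOn (fun y => |(fderiv ℝ φ.symm y).det|) φ.target :=
    φ.symm.continuousOn_abs_det_fderiv hφ'
  have hs : ContinuousOn φ.symm φ.target := φ.continuousOn_symm
  have hm : MapsTo φ.symm φ.target φ.source := φ.mapsTo_symm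
  -- `X₀` is the Piola transform of the field `ψ v`, and `θ₀` is that of its divergence. `X₀`
  -- contains first derivatives of `φ` and `φ⁻¹`, so it is only continuous.
  let θ₀ : EuclideanSpace ℝ (Fin n) → ℝ := fun y =>
    |(fderiv ℝ φ.symm y).det| * fderiv ℝ ψ (φ.symm y) v
  let X₀ : EuclideanSpace ℝ (Fin n) → EuclideanSpace ℝ (Fin n) := fun y =>
    (|(fderiv ℝ φ.symm y).det| * ψ (φ.symm y)) • fderiv ℝ φ (φ.symm y) v
  have hθ₀ : ContinuousOn θ₀ φ.target :=
    hdet.mul (((hψ.continuous_fderiv (by simp)).comp_continuousOn hs).clm_apply continuousOn_const)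
  have hX₀ : ContinuousOn X₀ φ.target :=
    (hdet.mul (hψ.continuous.comp_continuousOn hs)).smul
      (((φ.continuousOn_fderiv hφ).comp hs hm).clm_apply continuousOn_const)
  have hθ0 : ∀ y ∈ φ.target, y ∉ K → θ₀ y = 0 := fun y hy hyK => by
    simp [θ₀, fderiv_of_notMem_tsupport ℝ (hoff y hy hyK)]
  have hX0 : ∀ y ∈ φ.target, y ∉ K → X₀ y = 0 := fun y hy hyK => by
    simp [X₀, image_eq_zero_of_notMem_tsupport (hoff y hy hyK)]
  have ht : MeasurableSet φ.target := φ.open_target.measurableSet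
  have key := hfg.integral_mul_eq_neg_integral_inner φ.open_target hK hKU
    (continuous_indicator_of_isCompact φ.open_target hK hKU hθ₀ hθ0)
    (continuous_indicator_of_isCompact φ.open_target hK hKU hX₀ hX0)
    (support_indicator_subset_of_isCompact hθ0) (support_indicator_subset_of_isCompact hX0) ?_
  · rw [hcov, hcov]
    convert key using 1
    · refine setIntegral_congr_fun ht fun y hy => ?_
      simp only [indicator_of_mem hy, θ₀, Function.comp_apply, φ.right_inv hy]
      ring
    · congr 1
      refine setIntegral_congr_fun ht fun y hy => ?_
      simp only [indicator_of_mem hy, X₀, φ.right_inv hy, adjoint_inner_left, inner_smul_right]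
      ring
  -- The divergence identity is checked upstairs: `η ∘ φ` is `C^1`, so it may be integrated by parts
  -- classically against `ψ`, and the result is pushed forward.
  · intro η hη
    have hc := (ContDiffOn.hasWeakGradient φ.open_source
      (hη.comp_contDiffOn hφ)).integral_eq ψ hψ hψc hψU v
    rw [hcov, hcov] at hc
    convert hc using 1
    · rw [← integral_indicator ht]
      congr 1 with y
      by_cases hy : y ∈ φ.target
      · simp only [indicator_of_mem hy, θ₀, Function.comp_apply, φ.right_inv hy]
        ring
      · simp [indicator_of_notMem hy]
    · rw [← integral_indicator ht]
      congr 2 with y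
      by_cases hy : y ∈ φ.target
      · have h1 := (hη.differentiable one_ne_zero (φ (φ.symm y))).hasFDerivAt.comp (φ.symm y)
          (φ.hasFDerivAt_of_contDiffOn hφ (hm hy))
        simp only [indicator_of_mem hy, X₀, gradient, InnerProductSpace.toDual_symm_apply]
        rw [HasFDerivAt.fderiv h1]
        simp [φ.right_inv hy]
        ring
      · simp [indicator_of_notMem hy]

/-! ### Testing on oscillating functions -/

theorem exists_continuous_eq_one_on_compact {X : Type*} [TopologicalSpace X] [RegularSpace X]
    [LocallyCompactSpace X] {K U : Set X} (hK : IsCompact K) (hU : IsOpen U) (hKU : K ⊆ U) :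
    ∃ (χ : X → ℝ) (K' : Set X), Continuous χ ∧ IsCompact K' ∧ K' ⊆ U ∧ EqOn χ 1 K ∧
      (∀ x, x ∉ K' → χ x = 0) ∧ ∀ x, χ x ∈ Icc (0 : ℝ) 1 := by
  obtain ⟨K', hK', hKK', hK'U⟩ := exists_compact_between hK hU hKU
  obtain ⟨χ, h1, h0, -, h⟩ := exists_continuous_one_zero_of_isCompact hK
    isOpen_interior.isClosed_compl (disjoint_compl_right_iff_subset.2 hKK')
  exact ⟨χ, K', χ.continuous, hK', hK'U, h1, fun x hx => h0 fun h => hx (interior_subset h), h⟩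

/-- The absolute values dominate the squares, which sum to 1. It lets two phases replace averaging
over the phase. -/
theorem one_le_abs_cos_add_abs_cos_add_pi_div_two (t : ℝ) :
    1 ≤ |Real.cos t| + |Real.cos (t + Real.pi / 2)| := by
  rw [Real.cos_add_pi_div_two, abs_neg]
  nlinarith [abs_nonneg (Real.cos t), abs_nonneg (Real.sin t), sq_abs (Real.cos t),
    sq_abs (Real.sin t), Real.sin_sq_add_cos_sq t, Real.abs_cos_le_one t, Real.abs_sin_le_one t]

section Oscillation

variable {n : ℕ}

/-- The function `u`, modulated by a sine wave in direction `e` with frequency `l` and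
amplitude `1 / l`. -/
noncomputable def sineWave (u : EuclideanSpace ℝ (Fin n) → ℝ) (e : EuclideanSpace ℝ (Fin n))
    (l α : ℝ) (y : EuclideanSpace ℝ (Fin n)) : ℝ :=
  l⁻¹ * (u y * Real.sin (l * inner ℝ e y + α))

theorem contDiff_sineWave {u : EuclideanSpace ℝ (Fin n) → ℝ} (hu : ContDiff ℝ 1 u)
    (e : EuclideanSpace ℝ (Fin n)) (l α : ℝ) : ContDiff ℝ 1 (sineWave u e l α) := by
  unfold sineWave
  exact contDiff_const.mul (hu.mul (Real.contDiff_sin.comp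
    ((contDiff_const.mul (contDiff_const.inner ℝ contDiff_id)).add contDiff_const)))

/-- The amplitude `1/l` cancels the frequency: a term of order one along `e` remains, plus an error
of order `1/l`. -/
theorem gradient_sineWave {u : EuclideanSpace ℝ (Fin n) → ℝ} (hu : ContDiff ℝ 1 u)
    (e : EuclideanSpace ℝ (Fin n)) {l : ℝ} (hl : l ≠ 0) (α : ℝ) (y : EuclideanSpace ℝ (Fin n)) :
    gradient (sineWave u e l α) y = (u y * Real.cos (l * inner ℝ e y + α)) • e
      + (l⁻¹ * Real.sin (l * inner ℝ e y + α)) • gradient u y := by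
  have h1 : HasFDerivAt u (fderiv ℝ u y) y := (hu.differentiable one_ne_zero y).hasFDerivAt
  have h2 : HasFDerivAt (fun y => l * inner ℝ e y + α) (l • innerSL ℝ e) y :=
    (((innerSL ℝ e).hasFDerivAt (x := y)).const_mul l).add_const α
  have h3 := (h1.mul h2.sin).const_mul l⁻¹
  refine ext_inner_right ℝ fun v => ?_
  rw [gradient, InnerProductSpace.toDual_symm_apply]
  refine (congrArg (fun L => L v) (HasFDerivAt.fderiv h3)).trans ?_
  simp [gradient, inner_add_left, inner_smul_left]
  field_simp

open ContinuousLinearMap in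
/-- Testing a bounded composition operator on sine waves with a smooth amplitude. -/
theorem GeneratesBoundedComposition.exists_eLpNorm_smul_adjoint_le_of_contDiff {P Q : ℝ≥0∞}
    (hP : 1 ≤ P) (hQ : 1 ≤ Q)
    {φ : OpenPartialHomeomorph (EuclideanSpace ℝ (Fin n)) (EuclideanSpace ℝ (Fin n))}
    (hφ : ContDiffOn ℝ 1 φ φ.source) (hφ' : ContDiffOn ℝ 1 φ.symm φ.target)
    (h : GeneratesBoundedComposition φ.source φ.target φ P Q) :
    ∃ C : ℝ≥0, ∀ e : EuclideanSpace ℝ (Fin n), ‖e‖ ≤ 1 → ∀ u : EuclideanSpace ℝ (Fin n) → ℝ,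
      ContDiff ℝ 1 u → HasCompactSupport u → tsupport u ⊆ φ.target →
      eLpNorm (fun x => u (φ x) • adjoint (fderiv ℝ φ x) e) Q (volume.restrict φ.source)
        ≤ C * eLpNorm u P (volume.restrict φ.target) := by
  obtain ⟨hmem, K, hK⟩ := h
  -- One factor `K` for each of the two phases `0` and `π/2`.
  refine ⟨2 * K, fun e he u hu huc hut => ?_⟩
  have hu0 : ∀ y, y ∉ tsupport u → u y = 0 := fun y hy => image_eq_zero_of_notMem_tsupport hy
  have hgu : Continuous (gradient u) :=
    (InnerProductSpace.toDual ℝ (EuclideanSpace ℝ (Fin n))).symm.continuous.comp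
      (hu.continuous_fderiv one_ne_zero)
  have hgu0 : ∀ y, y ∉ tsupport u → gradient u y = 0 := fun y hy => by
    rw [gradient, fderiv_of_notMem_tsupport ℝ hy, map_zero]
  set T := φ.symm '' tsupport u with hT
  have hTc : IsCompact T := huc.isCompact.image_of_continuousOn (φ.continuousOn_symm.mono hut)
  have hTs : T ⊆ φ.source := (image_mono hut).trans φ.symm.image_source_eq_target.subset
  have hoff : ∀ x ∈ φ.source, x ∉ T → φ x ∉ tsupport u := fun x hx hxT h =>
    hxT ⟨φ x, h, φ.left_inv hx⟩
  have hA : ContinuousOn (fun x => adjoint (fderiv ℝ φ x)) φ.source :=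
    adjoint.continuous.comp_continuousOn (φ.continuousOn_fderiv hφ)
  have hsM : MeasurableSet φ.source := φ.open_source.measurableSet
  have hgm : MemLp (gradient u) P (volume.restrict φ.target) :=
    memLp_restrict_of_continuousOn φ.open_target huc hut hgu.continuousOn (fun y _ => hgu0 y) P
  have hum : MemLp u P (volume.restrict φ.target) :=
    memLp_restrict_of_continuousOn φ.open_target huc hut hu.continuous.continuousOn
      (fun y _ => hu0 y) P
  have hgc : ContinuousOn (fun x => adjoint (fderiv ℝ φ x) (gradient u (φ x))) φ.source :=
    hA.clm_apply (hgu.comp_continuousOn φ.continuousOn)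
  have hgm' : MemLp (fun x => adjoint (fderiv ℝ φ x) (gradient u (φ x))) Q
      (volume.restrict φ.source) :=
    memLp_restrict_of_continuousOn φ.open_source hTc hTs hgc
      (fun x hx hxT => by rw [hgu0 _ (hoff x hx hxT), map_zero]) Q
  set M₁ := eLpNorm (gradient u) P (volume.restrict φ.target)
  set M₂ := eLpNorm (fun x => adjoint (fderiv ℝ φ x) (gradient u (φ x))) Q
    (volume.restrict φ.source)
  set N := eLpNorm u P (volume.restrict φ.target)
  -- The leading part of the gradient of the composed sine wave.
  let B : ℝ → ℝ → EuclideanSpace ℝ (Fin n) → EuclideanSpace ℝ (Fin n) := fun l α x =>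
    (u (φ x) * Real.cos (l * inner ℝ e (φ x) + α)) • adjoint (fderiv ℝ φ x) e
  have hBc : ∀ l α, ContinuousOn (B l α) φ.source := fun l α =>
    ContinuousOn.smul (f := fun x => u (φ x) * Real.cos (l * inner ℝ e (φ x) + α))
      (Continuous.comp_continuousOn
        (g := fun y => u y * Real.cos (l * inner ℝ e y + α)) (by
          have := hu.continuous
          fun_prop) φ.continuousOn)
      (hA.clm_apply continuousOn_const)
  have hB : ∀ l : ℝ, 0 < l → ∀ α, eLpNorm (B l α) Q (volume.restrict φ.source)
      ≤ K * (N + ENNReal.ofReal l⁻¹ * M₁) + ENNReal.ofReal l⁻¹ * M₂ := by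
    intro l hl α
    have hw := (contDiff_sineWave hu e l α).contDiffOn.hasWeakGradient φ.open_target
    have hws := hw.comp_openPartialHomeomorph hφ hφ'
    have hcos : Continuous fun y => u y * Real.cos (l * inner ℝ e y + α) := by
      have := hu.continuous
      fun_prop
    have hsin : Continuous fun y : EuclideanSpace ℝ (Fin n) =>
        l⁻¹ * Real.sin (l * inner ℝ e y + α) := by
      fun_prop
    have habs : ∀ t : ℝ, |l⁻¹ * Real.sin t| ≤ l⁻¹ := fun t => by
      rw [abs_mul, abs_of_pos (inv_pos.2 hl)]
      exact mul_le_of_le_one_right (inv_pos.2 hl).le (Real.abs_sin_le_one _)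
    have hb1 : eLpNorm (gradient (sineWave u e l α)) P (volume.restrict φ.target)
        ≤ N + ENNReal.ofReal l⁻¹ * M₁ := by
      have : gradient (sineWave u e l α)
          = (fun y => (u y * Real.cos (l * inner ℝ e y + α)) • e)
            + fun y => (l⁻¹ * Real.sin (l * inner ℝ e y + α)) • gradient u y :=
        funext fun y => gradient_sineWave hu e hl.ne' α y
      rw [this]
      refine (eLpNorm_add_le (hcos.smul continuous_const).aestronglyMeasurable
        (hsin.smul hgu).aestronglyMeasurable hP).trans (add_le_add ?_ ?_)
      · refine eLpNorm_mono fun y => ?_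
        rw [Pi.smul_apply', norm_smul, norm_mul, mul_assoc]
        refine mul_le_of_le_one_right (norm_nonneg _) ?_
        exact mul_le_one₀ (Real.abs_cos_le_one _) (norm_nonneg _) he
      · refine eLpNorm_le_mul_eLpNorm_of_ae_le_mul (.of_forall fun y => ?_) _
        rw [Pi.smul_apply', norm_smul]
        exact mul_le_mul_of_nonneg_right (habs _) (norm_nonneg _)
    have hmF : MemHomSobolev φ.target P (sineWave u e l α) := by
      refine ⟨⟨_, hw⟩, ?_⟩
      rw [homSobolevSeminorm_eq φ.open_target P hw]
      exact hb1.trans_lt (ENNReal.add_lt_top.2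
        ⟨hum.2, ENNReal.mul_lt_top ENNReal.ofReal_lt_top hgm.2⟩)
    have hb2 := hK _ hmF
    rw [homSobolevSeminorm_eq φ.open_target P hw, homSobolevSeminorm_eq φ.open_source Q hws] at hb2
    have : B l α = (fun x => adjoint (fderiv ℝ φ x) (gradient (sineWave u e l α) (φ x)))
        - fun x => (l⁻¹ * Real.sin (l * inner ℝ e (φ x) + α)) •
          adjoint (fderiv ℝ φ x) (gradient u (φ x)) := by
      ext1 x
      simp only [B, Pi.sub_apply, gradient_sineWave hu e hl.ne' α, map_add, map_smul,
        add_sub_cancel_right]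
    have hsc : ContinuousOn (fun x => (l⁻¹ * Real.sin (l * inner ℝ e (φ x) + α)) •
          adjoint (fderiv ℝ φ x) (gradient u (φ x))) φ.source :=
      (hsin.comp_continuousOn φ.continuousOn).smul hgc
    rw [this]
    refine (eLpNorm_sub_le ?_ (hsc.aestronglyMeasurable hsM) hQ).trans (add_le_add ?_ ?_)
    · refine ContinuousOn.aestronglyMeasurable ?_ hsM
      refine hA.clm_apply (Continuous.comp_continuousOn (g := gradient (sineWave u e l α)) ?_
        φ.continuousOn)
      exact (InnerProductSpace.toDual ℝ (EuclideanSpace ℝ (Fin n))).symm.continuous.comp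
        ((contDiff_sineWave hu e l α).continuous_fderiv one_ne_zero)
    · exact hb2.trans (mul_le_mul_right hb1 _)
    · refine eLpNorm_le_mul_eLpNorm_of_ae_le_mul (.of_forall fun y => ?_) _
      rw [norm_smul]
      exact mul_le_mul_of_nonneg_right (habs _) (norm_nonneg _)
  have hS : ∀ l : ℝ, 0 < l →
      eLpNorm (fun x => u (φ x) • adjoint (fderiv ℝ φ x) e) Q (volume.restrict φ.source)
        ≤ 2 * K * N + ENNReal.ofReal l⁻¹ * (2 * (K * M₁ + M₂)) := by
    intro l hl
    have h1 : eLpNorm (fun x => u (φ x) • adjoint (fderiv ℝ φ x) e) Q (volume.restrict φ.source)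
        ≤ eLpNorm ((fun x => ‖B l 0 x‖) + fun x => ‖B l (Real.pi / 2) x‖) Q
          (volume.restrict φ.source) := by
      refine eLpNorm_mono_real fun x => ?_
      simp only [B, Pi.add_apply, norm_smul, norm_mul, Real.norm_eq_abs, add_zero]
      have := one_le_abs_cos_add_abs_cos_add_pi_div_two (l * inner ℝ e (φ x))
      have h0 : 0 ≤ |u (φ x)| * ‖adjoint (fderiv ℝ φ x) e‖ := by positivity
      nlinarith
    refine h1.trans ((eLpNorm_add_le ((hBc l 0).norm.aestronglyMeasurable hsM)
      ((hBc l _).norm.aestronglyMeasurable hsM) hQ).trans ?_)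
    rw [eLpNorm_norm, eLpNorm_norm]
    refine (add_le_add (hB l hl 0) (hB l hl _)).trans (le_of_eq ?_)
    ring
  have hlim : Tendsto (fun k : ℕ => 2 * (K : ℝ≥0∞) * N
      + ENNReal.ofReal ((k : ℝ) + 1)⁻¹ * (2 * (K * M₁ + M₂))) atTop
      (𝓝 (2 * K * N + 0 * (2 * (K * M₁ + M₂)))) := by
    refine tendsto_const_nhds.add (ENNReal.Tendsto.mul_const ?_ (Or.inr ?_))
    · rw [← ENNReal.ofReal_zero]
      refine ENNReal.tendsto_ofReal ?_
      exact tendsto_one_div_add_atTop_nhds_zero_nat.congr fun k => by simp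
    · exact ENNReal.mul_ne_top (by simp)
        (ENNReal.add_ne_top.2 ⟨ENNReal.mul_ne_top ENNReal.coe_ne_top hgm.2.ne, hgm'.2.ne⟩)
  have := ge_of_tendsto' hlim fun k => hS ((k : ℝ) + 1) (by positivity)
  simpa using this

-- Passes from `C^1` to continuous amplitudes, which is needed because the later test functions
-- involve powers of the Jacobian of a `C^1` map.
open ContinuousLinearMap in
theorem GeneratesBoundedComposition.exists_eLpNorm_smul_adjoint_le {P Q : ℝ≥0∞}
    (hP : 1 ≤ P) (hQ : 1 ≤ Q)
    {φ : OpenPartialHomeomorph (EuclideanSpace ℝ (Fin n)) (EuclideanSpace ℝ (Fin n))}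
    (hφ : ContDiffOn ℝ 1 φ φ.source) (hφ' : ContDiffOn ℝ 1 φ.symm φ.target)
    (h : GeneratesBoundedComposition φ.source φ.target φ P Q) :
    ∃ C : ℝ≥0, ∀ e : EuclideanSpace ℝ (Fin n), ‖e‖ ≤ 1 → ∀ u : EuclideanSpace ℝ (Fin n) → ℝ,
      ∀ K : Set (EuclideanSpace ℝ (Fin n)), IsCompact K → K ⊆ φ.target →
      Continuous u → Function.support u ⊆ K →
      eLpNorm (fun x => u (φ x) • adjoint (fderiv ℝ φ x) e) Q (volume.restrict φ.source)
        ≤ C * eLpNorm u P (volume.restrict φ.target) := by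
  obtain ⟨C, hC⟩ := h.exists_eLpNorm_smul_adjoint_le_of_contDiff hP hQ hφ hφ'
  refine ⟨C, fun e he u K hK hKU hu huK => ?_⟩
  obtain ⟨χ, K', hχ, hK', hK'U, hχ1, hχ0, hχI⟩ :=
    exists_continuous_eq_one_on_compact hK φ.open_target hKU
  have hsM : MeasurableSet φ.source := φ.open_source.measurableSet
  have hA : ContinuousOn (fun x => adjoint (fderiv ℝ φ x) e) φ.source :=
    (adjoint.continuous.comp_continuousOn (φ.continuousOn_fderiv hφ)).clm_apply continuousOn_const
  have hN₁ : MemLp χ P (volume.restrict φ.target) :=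
    memLp_restrict_of_continuousOn φ.open_target hK' hK'U hχ.continuousOn (fun y _ => hχ0 y) P
  have hN₂ : MemLp (fun x => χ (φ x) • adjoint (fderiv ℝ φ x) e) Q (volume.restrict φ.source) := by
    refine memLp_restrict_of_continuousOn φ.open_source
      (hK'.image_of_continuousOn (φ.continuousOn_symm.mono hK'U))
      ((image_mono hK'U).trans φ.symm.image_source_eq_target.subset)
      ((hχ.comp_continuousOn φ.continuousOn).smul hA) (fun x hx hxT => ?_) Q
    rw [Pi.smul_apply', Function.comp_apply, hχ0 _ fun h => hxT ⟨φ x, h, φ.left_inv hx⟩, zero_smul]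
  have hb : ∀ η : ℝ, 0 < η →
      eLpNorm (fun x => u (φ x) • adjoint (fderiv ℝ φ x) e) Q (volume.restrict φ.source)
        ≤ C * eLpNorm u P (volume.restrict φ.target) + ENNReal.ofReal η *
          (C * eLpNorm χ P (volume.restrict φ.target)
            + eLpNorm (fun x => χ (φ x) • adjoint (fderiv ℝ φ x) e) Q
              (volume.restrict φ.source)) := by
    intro η hη
    -- The approximation does not enlarge the support, so its error is at most `η χ` for one fixed
    -- cutoff `χ`, and both error norms are `η` times a finite constant.
    obtain ⟨g, hg, hgu, hgs⟩ := hu.exists_contDiff_approx 1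
      (continuous_const (y := η)) (fun _ => hη)
    have hgK : Function.support g ⊆ K := hgs.trans huK
    have hgt : tsupport g ⊆ K := closure_minimal hgK hK.isClosed
    have hd : ∀ y, |g y - u y| ≤ η * χ y := by
      intro y
      by_cases hy : y ∈ K
      · rw [hχ1 hy, Pi.one_apply, mul_one]
        exact (hgu y).le
      · have h1 : g y = 0 := Function.notMem_support.1 fun h => hy (hgK h)
        have h2 : u y = 0 := Function.notMem_support.1 fun h => hy (huK h)
        rw [h1, h2, sub_zero, abs_zero]
        exact mul_nonneg hη.le (hχI y).1
    have hχa : ∀ y, η * χ y = η * |χ y| := fun y => by rw [abs_of_nonneg (hχI y).1]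
    have h1 := hC e he g hg (HasCompactSupport.of_support_subset_isCompact hK hgK) (hgt.trans hKU)
    have h2 : eLpNorm g P (volume.restrict φ.target) ≤ eLpNorm u P (volume.restrict φ.target)
        + ENNReal.ofReal η * eLpNorm χ P (volume.restrict φ.target) := by
      have : g = u + (g - u) := by simp
      rw [this]
      refine (eLpNorm_add_le hu.aestronglyMeasurable
        (hg.continuous.sub hu).aestronglyMeasurable hP).trans (add_le_add le_rfl ?_)
      exact eLpNorm_le_mul_eLpNorm_of_ae_le_mul (.of_forall fun y => (hd y).trans (hχa y).le) _
    have h3 : eLpNorm (fun x => u (φ x) • adjoint (fderiv ℝ φ x) e) Q (volume.restrict φ.source)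
        ≤ eLpNorm (fun x => g (φ x) • adjoint (fderiv ℝ φ x) e) Q (volume.restrict φ.source)
          + ENNReal.ofReal η * eLpNorm (fun x => χ (φ x) • adjoint (fderiv ℝ φ x) e) Q
              (volume.restrict φ.source) := by
      have : (fun x => u (φ x) • adjoint (fderiv ℝ φ x) e)
          = (fun x => g (φ x) • adjoint (fderiv ℝ φ x) e)
            - fun x => (g (φ x) - u (φ x)) • adjoint (fderiv ℝ φ x) e := by
        ext1 x
        simp [sub_smul]
      rw [this]
      refine (eLpNorm_sub_le
        (((hg.continuous.comp_continuousOn φ.continuousOn).smul hA).aestronglyMeasurable hsM)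
        ((((hg.continuous.sub hu).comp_continuousOn φ.continuousOn).smul hA).aestronglyMeasurable
          hsM) hQ).trans (add_le_add le_rfl ?_)
      refine eLpNorm_le_mul_eLpNorm_of_ae_le_mul (.of_forall fun x => ?_) _
      rw [Pi.smul_apply', norm_smul, norm_smul, ← mul_assoc]
      exact mul_le_mul_of_nonneg_right ((hd _).trans (hχa _).le) (norm_nonneg _)
    calc _ ≤ _ := h3
      _ ≤ C * (eLpNorm u P (volume.restrict φ.target)
        + ENNReal.ofReal η * eLpNorm χ P (volume.restrict φ.target)) + _ :=
          add_le_add (h1.trans (mul_le_mul_right h2 _)) le_rfl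
      _ = _ := by ring
  refine ge_of_tendsto' (f := fun k : ℕ => _) (x := atTop) ?_
    fun k : ℕ => hb (1 / ((k : ℝ) + 1)) (by positivity)
  conv => enter [3, 1]; rw [← add_zero (_ * _), ← zero_mul (C * eLpNorm χ P (volume.restrict φ.target)
            + eLpNorm (fun x => χ (φ x) • adjoint (fderiv ℝ φ x) e) Q
              (volume.restrict φ.source))]
  refine tendsto_const_nhds.add (ENNReal.Tendsto.mul_const ?_ (Or.inr ?_))
  · rw [← ENNReal.ofReal_zero]
    exact ENNReal.tendsto_ofReal tendsto_one_div_add_atTop_nhds_zero_nat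
  · exact ENNReal.add_ne_top.2 ⟨ENNReal.mul_ne_top ENNReal.coe_ne_top hN₁.2.ne, hN₂.2.ne⟩

end Oscillation

/-! ### Converse of Hölder's inequality -/

/-- A converse of Hölder's inequality for a continuous function on an open set, tested
on continuous functions that vanish off a compact set. -/
theorem eLpNorm_le_of_forall_eLpNorm_mul_le {E : Type*} [NormedAddCommGroup E] [NormedSpace ℝ E]
    [FiniteDimensional ℝ E] [MeasurableSpace E] [BorelSpace E] {μ : Measure E}
    [IsFiniteMeasureOnCompacts μ] {U : Set E} (hU : IsOpen U) {Φ : E → ℝ}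
    (hΦ : ContinuousOn Φ U) {p q κ : ℝ} (hp : 0 < p) (hq : 0 < q)
    (hκ : 0 < κ) (hpq : 1 / q = 1 / p + 1 / κ) {C : ℝ≥0∞}
    (h : ∀ (s : E → ℝ) (K : Set E), IsCompact K → K ⊆ U → ContinuousOn s U →
      (∀ x ∈ U, x ∉ K → s x = 0) →
      eLpNorm (fun x => s x * Φ x) (ENNReal.ofReal q) (μ.restrict U)
        ≤ C * eLpNorm s (ENNReal.ofReal p) (μ.restrict U)) :
    eLpNorm Φ (ENNReal.ofReal κ) (μ.restrict U) ≤ C := by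
  have hκq : κ / q = κ / p + 1 := by
    have : κ * (1 / q) = κ * (1 / p + 1 / κ) := by rw [hpq]
    field_simp at this ⊢
    linarith
  have hcomp : ∀ K, IsCompact K → K ⊆ U →
      eLpNorm Φ (ENNReal.ofReal κ) (μ.restrict K) ≤ C := by
    intro K hK hKU
    obtain ⟨χ, K', hχ, hK', hK'U, hχ1, hχ0, hχI⟩ := exists_continuous_eq_one_on_compact hK hU hKU
    have hw : ContinuousOn (fun x => χ x * Φ x) U := hχ.continuousOn.mul hΦ
    have hw0 : ∀ x ∈ U, x ∉ K' → χ x * Φ x = 0 := fun x _ hx => by rw [hχ0 x hx, zero_mul]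
    have hm : MemLp (fun x => χ x * Φ x) (ENNReal.ofReal κ) (μ.restrict U) :=
      memLp_restrict_of_continuousOn hU hK' hK'U hw hw0 _
    set W := eLpNorm (fun x => χ x * Φ x) (ENNReal.ofReal κ) (μ.restrict U) with hW
    have hnorm : ∀ r : ℝ, 0 < r →
        eLpNorm (fun x => ‖χ x * Φ x‖ ^ (κ / r)) (ENNReal.ofReal r) (μ.restrict U)
          = W ^ (κ / r) := by
      intro r hr
      rw [eLpNorm_norm_rpow _ (div_pos hκ hr), ← ENNReal.ofReal_mul hr.le,
        mul_div_cancel₀ _ hr.ne']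
    -- The extremal choice `s = |χΦ|^(κ/p)`: since `κ/q = κ/p + 1`, the hypothesis becomes `W^(κ/p +
    -- 1) ≤ C W^(κ/p)`, and `W` is finite thanks to the cutoff.
    have h1 := h (fun x => ‖χ x * Φ x‖ ^ (κ / p)) K' hK' hK'U
      (hw.norm.rpow_const fun x _ => Or.inr (div_pos hκ hp).le)
      (fun x hx hxK => by rw [hw0 x hx hxK, norm_zero, Real.zero_rpow (div_pos hκ hp).ne'])
    rw [hnorm p hp] at h1
    have h2 : W ^ (κ / q) ≤ C * W ^ (κ / p) := by
      refine le_trans ?_ h1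
      rw [← hnorm q hq]
      refine eLpNorm_mono_ae ((ae_restrict_iff' hU.measurableSet).2 (.of_forall fun x hx => ?_))
      have hle : ‖χ x * Φ x‖ ≤ ‖Φ x‖ := by
        rw [norm_mul, Real.norm_of_nonneg (hχI x).1]
        exact mul_le_of_le_one_left (norm_nonneg _) (hχI x).2
      have hpos : 0 ≤ ‖χ x * Φ x‖ ^ (κ / p) := Real.rpow_nonneg (norm_nonneg _) _
      rw [norm_mul (‖χ x * Φ x‖ ^ (κ / p)) (Φ x), Real.norm_of_nonneg hpos,
        Real.norm_of_nonneg (Real.rpow_nonneg (norm_nonneg _) _), hκq,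
        Real.rpow_add_one' (norm_nonneg _) (by positivity)]
      exact mul_le_mul_of_nonneg_left hle hpos
    have h3 : W ≤ C := by
      rcases eq_or_ne W 0 with h0 | h0
      · simp [h0]
      have hWt : W ≠ ∞ := hm.2.ne
      rw [hκq, ENNReal.rpow_add _ _ h0 hWt, ENNReal.rpow_one, mul_comm] at h2
      exact (ENNReal.mul_le_mul_iff_left (by simp [ENNReal.rpow_eq_zero_iff, h0, hWt])
        (ENNReal.rpow_ne_top_of_nonneg (div_pos hκ hp).le hWt)).1 h2
    calc eLpNorm Φ (ENNReal.ofReal κ) (μ.restrict K)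
        = eLpNorm (fun x => χ x * Φ x) (ENNReal.ofReal κ) (μ.restrict K) := by
          refine eLpNorm_congr_ae ((ae_restrict_iff' hK.measurableSet).2
            (.of_forall fun x hx => ?_))
          simp only [hχ1 hx, Pi.one_apply, one_mul]
      _ ≤ W := eLpNorm_mono_measure _ (Measure.restrict_mono hKU le_rfl)
      _ ≤ C := h3
  -- The bound is uniform in `K`, so monotone convergence along a compact exhaustion gives it on
  -- `U`.
  have : LocallyCompactSpace U := hU.locallyCompactSpace
  let T : CompactExhaustion U := CompactExhaustion.choice U
  have hTU : ⋃ k, ((↑) '' T k : Set E) = U := by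
    rw [← image_iUnion, T.iUnion_eq, image_univ, Subtype.range_coe]
  have hTd : Directed (· ⊆ ·) fun k => ((↑) '' T k : Set E) :=
    (monotone_nat_of_le_succ fun k => image_mono (T.subset (Nat.le_succ k))).directed_le
  have hk0 : ENNReal.ofReal κ ≠ 0 := by simpa using hκ
  have hle : ∀ k, eLpNorm Φ (ENNReal.ofReal κ) (μ.restrict ((↑) '' T k : Set E)) ≤ C := fun k =>
    hcomp _ ((T.isCompact k).image continuous_subtype_val)
      (by rintro _ ⟨x, _, rfl⟩; exact x.2)
  simp only [eLpNorm_eq_lintegral_rpow_enorm_toReal hk0 ENNReal.ofReal_ne_top,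
    ENNReal.toReal_ofReal hκ.le, one_div] at hle ⊢
  simp only [ENNReal.rpow_inv_le_iff hκ] at hle ⊢
  conv_lhs => rw [← hTU]
  rw [setLIntegral_iUnion_of_directed _ hTd]
  exact iSup_le hle

/-! ### Integrability of the dilatations -/

section Dilatation

variable {n : ℕ}

open ContinuousLinearMap in
/-- The `p`-dilatation of `φ` in direction `e`. -/
noncomputable def dilatation
    (φ : OpenPartialHomeomorph (EuclideanSpace ℝ (Fin n)) (EuclideanSpace ℝ (Fin n))) (p : ℝ)
    (e x : EuclideanSpace ℝ (Fin n)) : ℝ :=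
  |(fderiv ℝ φ x).det| ^ (-(1 / p)) * ‖adjoint (fderiv ℝ φ x) e‖

theorem dilatation_nonneg
    (φ : OpenPartialHomeomorph (EuclideanSpace ℝ (Fin n)) (EuclideanSpace ℝ (Fin n))) (p : ℝ)
    (e x : EuclideanSpace ℝ (Fin n)) : 0 ≤ dilatation φ p e x := by
  unfold dilatation
  positivity

variable {φ : OpenPartialHomeomorph (EuclideanSpace ℝ (Fin n)) (EuclideanSpace ℝ (Fin n))}

theorem continuousOn_abs_det_fderiv_rpow (hφ : ContDiffOn ℝ 1 φ φ.source)
    (hφ' : ContDiffOn ℝ 1 φ.symm φ.target) (r : ℝ) :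
    ContinuousOn (fun x => |(fderiv ℝ φ x).det| ^ r) φ.source :=
  (φ.continuousOn_abs_det_fderiv hφ).rpow_const fun _ hx =>
    Or.inl (abs_ne_zero.2 (φ.det_fderiv_ne_zero hφ hφ' hx))

open ContinuousLinearMap in
theorem continuousOn_dilatation (hφ : ContDiffOn ℝ 1 φ φ.source)
    (hφ' : ContDiffOn ℝ 1 φ.symm φ.target) (p : ℝ) (e : EuclideanSpace ℝ (Fin n)) :
    ContinuousOn (dilatation φ p e) φ.source :=
  (continuousOn_abs_det_fderiv_rpow hφ hφ' _).mul
    ((adjoint.continuous.comp_continuousOn (φ.continuousOn_fderiv hφ)).clm_apply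
      continuousOn_const).norm

theorem eLpNorm_restrict_target {F : Type*} [NormedAddCommGroup F] [NormedSpace ℝ F]
    (hφ : ContDiffOn ℝ 1 φ φ.source) {r : ℝ} (hr : 0 < r)
    (h : EuclideanSpace ℝ (Fin n) → F) :
    eLpNorm h (ENNReal.ofReal r) (volume.restrict φ.target)
      = eLpNorm (fun x => |(fderiv ℝ φ x).det| ^ (1 / r) • h (φ x)) (ENNReal.ofReal r)
        (volume.restrict φ.source) := by
  have hr0 : ENNReal.ofReal r ≠ 0 := by simpa using hr
  rw [eLpNorm_eq_lintegral_rpow_enorm_toReal hr0 ENNReal.ofReal_ne_top,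
    eLpNorm_eq_lintegral_rpow_enorm_toReal hr0 ENNReal.ofReal_ne_top,
    ENNReal.toReal_ofReal hr.le, φ.lintegral_target_eq hφ]
  congr 2 with x
  rw [enorm_smul, ENNReal.mul_rpow_of_nonneg _ _ hr.le,
    Real.enorm_of_nonneg (Real.rpow_nonneg (abs_nonneg _) _),
    ENNReal.ofReal_rpow_of_nonneg (Real.rpow_nonneg (abs_nonneg _) _) hr.le,
    ← Real.rpow_mul (abs_nonneg _), one_div_mul_cancel hr.ne', Real.rpow_one]

open ContinuousLinearMap in
theorem GeneratesBoundedComposition.exists_eLpNorm_mul_dilatation_le {p q : ℝ}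
    (hp : 1 ≤ p) (hq : 1 ≤ q)
    (hφ : ContDiffOn ℝ 1 φ φ.source) (hφ' : ContDiffOn ℝ 1 φ.symm φ.target)
    (h : GeneratesBoundedComposition φ.source φ.target φ (ENNReal.ofReal p) (ENNReal.ofReal q)) :
    ∃ C : ℝ≥0, ∀ e : EuclideanSpace ℝ (Fin n), ‖e‖ ≤ 1 →
      ∀ (s : EuclideanSpace ℝ (Fin n) → ℝ) (K : Set (EuclideanSpace ℝ (Fin n))),
      IsCompact K → K ⊆ φ.source → ContinuousOn s φ.source → (∀ x ∈ φ.source, x ∉ K → s x = 0) →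
      eLpNorm (fun x => s x * dilatation φ p e x) (ENNReal.ofReal q) (volume.restrict φ.source)
        ≤ C * eLpNorm s (ENNReal.ofReal p) (volume.restrict φ.source) := by
  have hp0 : 0 < p := by linarith
  obtain ⟨C, hC⟩ := h.exists_eLpNorm_smul_adjoint_le
    (by simpa using ENNReal.ofReal_le_ofReal hp) (by simpa using ENNReal.ofReal_le_ofReal hq) hφ hφ'
  refine ⟨C, fun e he s K hK hKs hs hs0 => ?_⟩
  have hK' : IsCompact (φ '' K) := hK.image_of_continuousOn (φ.continuousOn.mono hKs)
  have hK't : φ '' K ⊆ φ.target := (image_mono hKs).trans φ.image_source_eq_target.subset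
  -- Chosen so that `|J|^(1/p) v = s`: the `L^p` norm of `v ∘ φ⁻¹` on the target is that of `s` on
  -- the source.
  let v : EuclideanSpace ℝ (Fin n) → ℝ := fun x => |(fderiv ℝ φ x).det| ^ (-(1 / p)) * s x
  have hv : ContinuousOn (v ∘ φ.symm) φ.target :=
    ((continuousOn_abs_det_fderiv_rpow hφ hφ' _).mul hs).comp φ.continuousOn_symm φ.mapsTo_symm
  have hv0 : ∀ y ∈ φ.target, y ∉ φ '' K → (v ∘ φ.symm) y = 0 := fun y hy hyK => by
    simp only [v, Function.comp_apply]
    rw [hs0 _ (φ.mapsTo_symm hy) fun h => hyK ⟨φ.symm y, h, φ.right_inv hy⟩, mul_zero]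
  have key := hC e he _ (φ '' K) hK' hK't
    (continuous_indicator_of_isCompact φ.open_target hK' hK't hv hv0)
    (support_indicator_subset_of_isCompact hv0)
  have hu : ∀ x ∈ φ.source, φ.target.indicator (v ∘ φ.symm) (φ x) = v x := fun x hx => by
    rw [indicator_of_mem (φ.map_source hx), Function.comp_apply, φ.left_inv hx]
  rw [eLpNorm_restrict_target hφ hp0] at key
  convert! key using 1
  · refine eLpNorm_congr_norm_ae ((ae_restrict_iff' φ.open_source.measurableSet).2
      (.of_forall fun x hx => ?_))
    rw [hu x hx, norm_smul, norm_mul, Real.norm_of_nonneg (dilatation_nonneg φ p e x)]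
    simp only [v, dilatation, norm_mul]
    rw [Real.norm_of_nonneg (Real.rpow_nonneg (abs_nonneg _) _)]
    ring
  · congr 1
    refine eLpNorm_congr_ae ((ae_restrict_iff' φ.open_source.measurableSet).2
      (.of_forall fun x hx => ?_))
    have hd : 0 < |(fderiv ℝ φ x).det| := abs_pos.2 (φ.det_fderiv_ne_zero hφ hφ' hx)
    simp only [hu x hx, smul_eq_mul, v]
    rw [← mul_assoc, ← Real.rpow_add hd, add_neg_cancel, Real.rpow_zero, one_mul]

/-- A bounded composition operator `L¹_p → L¹_q`, `q < p`, has dilatations in `L^κ`,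
`1/κ = 1/q - 1/p`. -/
theorem GeneratesBoundedComposition.memLp_dilatation {p q κ : ℝ}
    (hp : 1 ≤ p) (hq : 1 ≤ q) (hκ : 0 < κ) (hpq : 1 / q = 1 / p + 1 / κ)
    (hφ : ContDiffOn ℝ 1 φ φ.source) (hφ' : ContDiffOn ℝ 1 φ.symm φ.target)
    (h : GeneratesBoundedComposition φ.source φ.target φ (ENNReal.ofReal p) (ENNReal.ofReal q))
    {e : EuclideanSpace ℝ (Fin n)} (he : ‖e‖ ≤ 1) :
    MemLp (dilatation φ p e) (ENNReal.ofReal κ) (volume.restrict φ.source) := by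
  obtain ⟨C, hC⟩ := h.exists_eLpNorm_mul_dilatation_le hp hq hφ hφ'
  have hc := continuousOn_dilatation hφ hφ' p e
  exact ⟨hc.aestronglyMeasurable φ.open_source.measurableSet,
    (eLpNorm_le_of_forall_eLpNorm_mul_le φ.open_source hc
      (by linarith) (by linarith) hκ hpq
      (hC e he)).trans_lt ENNReal.coe_lt_top⟩

end Dilatation

/-! ### The planar inverse estimate -/

open ContinuousLinearMap in
/-- In the plane, a right inverse of `A` has norm at most the sum of the norms of the rows
of `A`, divided by `|det A|`. -/
theorem abs_det_mul_opNorm_le {A B : EuclideanSpace ℝ (Fin 2) →L[ℝ] EuclideanSpace ℝ (Fin 2)}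
    (hAB : ∀ w, A (B w) = w) :
    |A.det| * ‖B‖ ≤ ‖adjoint A (EuclideanSpace.single 0 1)‖
      + ‖adjoint A (EuclideanSpace.single 1 1)‖ := by
  set R₀ := adjoint A (EuclideanSpace.single 0 1) with hR₀
  set R₁ := adjoint A (EuclideanSpace.single 1 1) with hR₁
  have h0 : ∀ v, A v 0 = R₀ 0 * v 0 + R₀ 1 * v 1 := fun v => by
    have : inner ℝ R₀ v = inner ℝ (EuclideanSpace.single 0 1) (A v) := by
      rw [hR₀, adjoint_inner_left]
    simpa [PiLp.inner_apply, Fin.sum_univ_two, mul_comm] using this.symm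
  have h1 : ∀ v, A v 1 = R₁ 0 * v 0 + R₁ 1 * v 1 := fun v => by
    have : inner ℝ R₁ v = inner ℝ (EuclideanSpace.single 1 1) (A v) := by
      rw [hR₁, adjoint_inner_left]
    simpa [PiLp.inner_apply, Fin.sum_univ_two, mul_comm] using this.symm
  have hdet : A.det = R₀ 0 * R₁ 1 - R₀ 1 * R₁ 0 := by
    rw [ContinuousLinearMap.det, ← LinearMap.det_toMatrix (EuclideanSpace.basisFun (Fin 2) ℝ).toBasis,
      Matrix.det_fin_two]
    simp [LinearMap.toMatrix_apply, h0, h1]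
  rw [← Real.norm_eq_abs, ← norm_smul]
  refine opNorm_le_bound _ (by positivity) fun w => ?_
  set v := B w with hv
  have hw0 : w 0 = R₀ 0 * v 0 + R₀ 1 * v 1 := by rw [← h0, hv, hAB]
  have hw1 : w 1 = R₁ 0 * v 0 + R₁ 1 * v 1 := by rw [← h1, hv, hAB]
  -- Cramer's rule: the columns of the adjugate are the rows of `A` rotated by a right angle, hence
  -- of equal norm.
  have hdv : A.det • v = w 0 • !₂[R₁ 1, -R₁ 0] + w 1 • !₂[-R₀ 1, R₀ 0] := by
    ext i
    fin_cases i
    · simp [hdet, hw0, hw1]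
      ring
    · simp [hdet, hw0, hw1]
      ring
  have n1 : ‖(!₂[R₁ 1, -R₁ 0] : EuclideanSpace ℝ (Fin 2))‖ = ‖R₁‖ := by
    simp [EuclideanSpace.norm_eq, Fin.sum_univ_two, add_comm]
  have n0 : ‖(!₂[-R₀ 1, R₀ 0] : EuclideanSpace ℝ (Fin 2))‖ = ‖R₀‖ := by
    simp [EuclideanSpace.norm_eq, Fin.sum_univ_two, add_comm]
  calc ‖(A.det • B) w‖ = ‖w 0 • (!₂[R₁ 1, -R₁ 0] : EuclideanSpace ℝ (Fin 2))
        + w 1 • !₂[-R₀ 1, R₀ 0]‖ := by rw [smul_apply, ← hv, hdv]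
    _ ≤ ‖w 0‖ * ‖R₁‖ + ‖w 1‖ * ‖R₀‖ := by
        refine (norm_add_le _ _).trans ?_
        rw [norm_smul, norm_smul, n1, n0]
    _ ≤ ‖w‖ * ‖R₁‖ + ‖w‖ * ‖R₀‖ := by
        gcongr <;> exact PiLp.norm_apply_le _ _
    _ = (‖R₀‖ + ‖R₁‖) * ‖w‖ := by ring

open ContinuousLinearMap in
/-- In the plane, integrability of the dilatations of `φ` makes the inverse of `φ` generate a
bounded composition operator between the conjugate spaces. -/
theorem generatesBoundedComposition_symm_of_memLp_dilatation
    {φ : OpenPartialHomeomorph (EuclideanSpace ℝ (Fin 2)) (EuclideanSpace ℝ (Fin 2))}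
    {p p' q' κ : ℝ} (hp' : 1 < p') (hq' : 1 < q') (hκ : 1 ≤ κ) (hpp' : 1 / p + 1 / p' = 1)
    (hpq : 1 / p' = 1 / q' + 1 / κ)
    (hφ : ContDiffOn ℝ 1 φ φ.source) (hφ' : ContDiffOn ℝ 1 φ.symm φ.target)
    (h : ∀ i, MemLp (dilatation φ p (EuclideanSpace.single i 1)) (ENNReal.ofReal κ)
      (volume.restrict φ.source)) :
    GeneratesBoundedComposition φ.target φ.source φ.symm (ENNReal.ofReal q')
      (ENNReal.ofReal p') := by
  set Φ : EuclideanSpace ℝ (Fin 2) → ℝ :=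
    dilatation φ p (EuclideanSpace.single 0 1) + dilatation φ p (EuclideanSpace.single 1 1) with hΦ
  have hΦm : MemLp Φ (ENNReal.ofReal κ) (volume.restrict φ.source) := (h 0).add (h 1)
  have hΦ0 : ∀ x, 0 ≤ Φ x := fun x =>
    add_nonneg (dilatation_nonneg φ p _ x) (dilatation_nonneg φ p _ x)
  -- Hölder's inequality will be applied to the product of `Φ` in `L^κ` and `g` in `L^q'`.
  have hT : ENNReal.HolderTriple (ENNReal.ofReal κ) (ENNReal.ofReal q') (ENNReal.ofReal p') := by
    refine ⟨?_⟩
    rw [← ENNReal.ofReal_inv_of_pos (by linarith), ← ENNReal.ofReal_inv_of_pos (by linarith),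
      ← ENNReal.ofReal_inv_of_pos (by linarith), ← ENNReal.ofReal_add (by positivity) (by positivity)]
    congr 1
    simp only [one_div] at hpq
    linarith
  have key : ∀ (f : EuclideanSpace ℝ (Fin 2) → ℝ)
      (g : EuclideanSpace ℝ (Fin 2) → EuclideanSpace ℝ (Fin 2)),
      HasWeakGradient φ.source f g →
      HasWeakGradient φ.target (f ∘ φ.symm)
        (fun y => adjoint (fderiv ℝ φ.symm y) (g (φ.symm y))) ∧
      eLpNorm (fun y => adjoint (fderiv ℝ φ.symm y) (g (φ.symm y))) (ENNReal.ofReal p')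
        (volume.restrict φ.target)
        ≤ eLpNorm Φ (ENNReal.ofReal κ) (volume.restrict φ.source)
          * eLpNorm g (ENNReal.ofReal q') (volume.restrict φ.source) := by
    intro f g hfg
    refine ⟨HasWeakGradient.comp_openPartialHomeomorph (φ := φ.symm) hφ' (by simpa using hφ)
      (by simpa using hfg), ?_⟩
    have hgm : AEStronglyMeasurable g (volume.restrict φ.source) :=
      hfg.locallyIntegrableOn_grad.aestronglyMeasurable
    refine le_trans ?_ (eLpNorm_smul_le_mul_eLpNorm (r := ENNReal.ofReal p') hgm hΦm.1)
    rw [eLpNorm_restrict_target hφ (by linarith)]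
    refine eLpNorm_mono_ae ((ae_restrict_iff' φ.open_source.measurableSet).2
      (.of_forall fun x hx => ?_))
    have hd : 0 < |(fderiv ℝ φ x).det| := abs_pos.2 (φ.det_fderiv_ne_zero hφ hφ' hx)
    have hAB : ∀ w, fderiv ℝ φ x (fderiv ℝ φ.symm (φ x) w) = w := fun w => by
      have := φ.symm.fderiv_symm_apply_fderiv hφ' (by simpa using hφ) (φ.map_source hx) w
      simpa [φ.left_inv hx] using this
    have hB := abs_det_mul_opNorm_le hAB
    rw [Pi.smul_apply', norm_smul, norm_smul, φ.left_inv hx, Real.norm_of_nonneg (hΦ0 x),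
      Real.norm_of_nonneg (Real.rpow_nonneg hd.le _)]
    -- The weight `|J|^(1/p')` from the change of variables splits into the weight of the
    -- `p`-dilatation and the `|J|` that the adjugate bound absorbs.
    have hexp : |(fderiv ℝ φ x).det| ^ (1 / p')
        = |(fderiv ℝ φ x).det| ^ (-(1 / p)) * |(fderiv ℝ φ x).det| := by
      rw [← Real.rpow_add_one hd.ne']
      congr 1
      linarith
    calc |(fderiv ℝ φ x).det| ^ (1 / p') * ‖adjoint (fderiv ℝ φ.symm (φ x)) (g x)‖
        ≤ |(fderiv ℝ φ x).det| ^ (1 / p') * (‖fderiv ℝ φ.symm (φ x)‖ * ‖g x‖) := by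
          gcongr
          refine (le_opNorm _ _).trans (le_of_eq ?_)
          rw [LinearIsometryEquiv.norm_map]
      _ = |(fderiv ℝ φ x).det| ^ (-(1 / p))
          * (|(fderiv ℝ φ x).det| * ‖fderiv ℝ φ.symm (φ x)‖) * ‖g x‖ := by
          rw [hexp]
          ring
      _ ≤ |(fderiv ℝ φ x).det| ^ (-(1 / p))
          * (‖adjoint (fderiv ℝ φ x) (EuclideanSpace.single 0 1)‖
            + ‖adjoint (fderiv ℝ φ x) (EuclideanSpace.single 1 1)‖) * ‖g x‖ := by
          gcongr
      _ = Φ x * ‖g x‖ := by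
          simp only [hΦ, Pi.add_apply, dilatation]
          ring
  refine ⟨fun f hf => ?_, (eLpNorm Φ (ENNReal.ofReal κ) (volume.restrict φ.source)).toNNReal,
    fun f hf => ?_⟩
  · obtain ⟨⟨g, hg⟩, hlt⟩ := hf
    obtain ⟨h1, h2⟩ := key f g hg
    refine ⟨⟨_, h1⟩, ?_⟩
    rw [homSobolevSeminorm_eq φ.open_target _ h1]
    rw [homSobolevSeminorm_eq φ.open_source _ hg] at hlt
    exact h2.trans_lt (ENNReal.mul_lt_top hΦm.2 hlt)
  · obtain ⟨⟨g, hg⟩, -⟩ := hf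
    obtain ⟨h1, h2⟩ := key f g hg
    rw [homSobolevSeminorm_eq φ.open_target _ h1, homSobolevSeminorm_eq φ.open_source _ hg,
      ENNReal.coe_toNNReal hΦm.2.ne]
    exact h2

/-! ### The two implications -/

/-- In the plane, the inverse of a `C^1` diffeomorphism that generates a bounded composition
operator generates one between the conjugate spaces. -/
theorem GeneratesBoundedComposition.symm
    {φ : OpenPartialHomeomorph (EuclideanSpace ℝ (Fin 2)) (EuclideanSpace ℝ (Fin 2))}
    (hφ : ContDiffOn ℝ 1 φ φ.source) (hφ' : ContDiffOn ℝ 1 φ.symm φ.target)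
    {p q p' q' : ℝ} (hq : 1 < q) (hqp : q < p)
    (hp' : 1 / p + 1 / p' = 1) (hq' : 1 / q + 1 / q' = 1)
    (h : GeneratesBoundedComposition φ.source φ.target φ (ENNReal.ofReal p) (ENNReal.ofReal q)) :
    GeneratesBoundedComposition φ.target φ.source φ.symm (ENNReal.ofReal q')
      (ENNReal.ofReal p') := by
  have hpc : p.HolderConjugate p' := by
    rw [Real.holderConjugate_iff]
    exact ⟨by linarith, by simpa using hp'⟩
  have hqc : q.HolderConjugate q' := by
    rw [Real.holderConjugate_iff]
    exact ⟨hq, by simpa using hq'⟩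
  have hlt : 1 / p < 1 / q := one_div_lt_one_div_of_lt (by linarith) hqp
  have hle : 1 / q - 1 / p ≤ 1 := by
    have := hqc.symm.pos
    have : 0 < 1 / p := by have := hpc.pos; positivity
    have : 0 < 1 / q' := by positivity
    linarith
  -- Here `κ = 1/(1/q - 1/p)`; by conjugacy also `1/κ = 1/p' - 1/q'`.
  have hκ : 1 / (1 / (1 / q - 1 / p)) = 1 / q - 1 / p := one_div_one_div _
  have hκ1 : 1 ≤ 1 / (1 / q - 1 / p) := by
    rw [le_div_iff₀ (by linarith)]
    linarith
  refine generatesBoundedComposition_symm_of_memLp_dilatation hpc.symm.lt hqc.symm.lt hκ1 hp'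
    (by rw [hκ]; linarith) hφ hφ' fun i => ?_
  exact h.memLp_dilatation (by linarith) hq.le (by linarith) (by rw [hκ]; linarith) hφ hφ' (by simp)

theorem mainTheorem2
    (Ω Ω' : Set (EuclideanSpace ℝ (Fin 2)))
    (hΩ_open : IsOpen Ω) (hΩ_conn : IsConnected Ω)
    (hΩ'_open : IsOpen Ω') (hΩ'_conn : IsConnected Ω')
    (φ : OpenPartialHomeomorph (EuclideanSpace ℝ (Fin 2)) (EuclideanSpace ℝ (Fin 2)))
    (hsource : φ.source = Ω) (htarget : φ.target = Ω')
    (hφ : ContDiffOn ℝ 1 φ Ω) (hφ_symm : ContDiffOn ℝ 1 φ.symm Ω')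
    (p q p' q' : ℝ) (hq : 1 < q) (hqp : q < p)
    (hp' : 1 / p + 1 / p' = 1) (hq' : 1 / q + 1 / q' = 1) :
    GeneratesBoundedComposition Ω Ω' φ (ENNReal.ofReal p) (ENNReal.ofReal q) ↔
      GeneratesBoundedComposition Ω' Ω φ.symm (ENNReal.ofReal q') (ENNReal.ofReal p') := by
  subst hsource htarget
  have hpc : p.HolderConjugate p' := by
    rw [Real.holderConjugate_iff]
    exact ⟨by linarith, by simpa using hp'⟩
  have hqc : q.HolderConjugate q' := by
    rw [Real.holderConjugate_iff]
    exact ⟨hq, by simpa using hq'⟩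
  have hlt : p' < q' := by
    have : 1 / p < 1 / q := one_div_lt_one_div_of_lt (by linarith) hqp
    exact lt_of_one_div_lt_one_div hqc.symm.pos (by linarith)
  refine ⟨fun h => h.symm hφ hφ_symm hq hqp hp' hq', fun h => ?_⟩
  -- The pair `(q', p')` takes the role of `(p, q)`; its conjugate exponents are `q` and `p`.
  have := GeneratesBoundedComposition.symm (φ := φ.symm) hφ_symm (by simpa using hφ)
    hpc.symm.lt hlt ((add_comm _ _).trans hq') ((add_comm _ _).trans hp') h
  simpa using this
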